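/- Let $S^2$ be the unit two-sphere with its standard round metric $h_{AB}$, volume form $\epsilon_{AB}$ and Levi-Civita covariant derivative $D$, denoted by $||A$; indices are raised and lowered with $h$, $D^2=D_AD^A$, and integrals over $S^2$ are taken with respect to the volume of $h$. Let $N_A$ be a smooth one-form on $S^2$ (the angular momentum aspect at a fixed retarded time), let $\chi_{AB}$ be a smooth symmetric traceless tensor field on $S^2$ (the shear tensor at that time), and let $n:S^2\to\mathbb R$ be a linear combination of $l=1$ spherical harmonics. The Chruściel–Jezierski–Kijowski angular momentum is $$J^{(\mathrm{CJK})}=-\frac1{8\pi}\int_{S^2}\Bigl(3N_A+\tfrac14\chi_{AB}\chi^{BC}{}_{||C}\Bigr)\epsilon^{AD}n_{||D},$$ and, for $\alpha\in\mathbb R$, the Compère–Nichols angular momentum is $$J^{(\mathrm{CN})}=J^{(\mathrm{CJK})}-\frac{\alpha-1}{32\pi}\int_{S^2}\epsilon^{AD}n_{||D}\,\chi_{AB}\chi^{BC}{}_{||C}.$$ Let $b,c:S^2\to\mathbb R$ be smooth functions (the magnetic and the electric potential) such that $$\chi_{AB}=2c_{||AB}-h_{AB}D^2c+\epsilon_{AC}b^{||C}{}_{||B}+\epsilon_{BC}b^{||C}{}_{||A}.$$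 If $b=0$, then $J^{(\mathrm{CJK})}=J^{(\mathrm{CN})}$ for every $\alpha\in\mathbb R$. -/

import Mathlib

noncomputable section

open scoped Manifold ContDiff

namespace NullInfinity

/-- Euclidean three-space. -/
abbrev E3 : Type := EuclideanSpace ℝ (Fin 3)

/-- The unit two-sphere `S²`; the metric induced from `E3` is the standard round metric. -/
abbrev S2 : Type := Metric.sphere (0 : E3) 1

/-- Smooth real functions on the manifold `S²`. -/
def IsSmooth (f : S2 → ℝ) : Prop := ContMDiff (𝓡 2) 𝓘(ℝ, ℝ) ∞ f

/-!
Tensor fields on `S²` are written in the Cartesian components of the ambient space: a covariant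
tensor on the plane `T_x S² = x^⊥` is identified with the tensor on `E3` that agrees with it on
`x^⊥` and vanishes as soon as one argument is the normal `x`. On such tangential tensors,
contraction with the inverse round metric is the sum over a repeated Cartesian index, so there
is no need to distinguish upper from lower indices.
-/

/-- Smooth one-forms `η_A` on `S²`. -/
structure IsOneForm (η : S2 → Fin 3 → ℝ) : Prop where
  smooth : ∀ i, IsSmooth fun x => η x i
  tangential : ∀ x : S2, ∑ i, x.1 i * η x i = 0

/-- Smooth symmetric traceless tensor fields `T_{AB}` of rank two on `S²`. -/
structure IsSymmTracelessTensor (T : S2 → Fin 3 → Fin 3 → ℝ) : Prop where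
  smooth : ∀ i j, IsSmooth fun x => T x i j
  tangential : ∀ (x : S2) (j : Fin 3), ∑ i, x.1 i * T x i j = 0
  symm : ∀ (x : S2) (i j : Fin 3), T x i j = T x j i
  traceless : ∀ x : S2, ∑ i, T x i i = 0

/-- The extension of a function on `S²` to `E3 \ {0}` that is constant along rays from the
origin (with value `0` at the origin). -/
def radialExt (f : S2 → ℝ) (y : E3) : ℝ :=
  if hy : y = 0 then 0
  else f ⟨‖y‖⁻¹ • y, by
    simp only [mem_sphere_zero_iff_norm, norm_smul, norm_inv, norm_norm]
    exact inv_mul_cancel₀ (norm_ne_zero_iff.mpr hy)⟩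

/-- The differential of `f : S² → ℝ` at `x`, applied to the tangential part of the `k`-th
Cartesian basis vector. As `k` varies these are the components `f_{||k}` of the one-form `df`. -/
def grad (f : S2 → ℝ) (x : S2) (k : Fin 3) : ℝ :=
  fderiv ℝ (radialExt f) (x : E3) (EuclideanSpace.single k 1)

/-- The round metric `h_{ij} = δ_{ij} - x_i x_j`; as a matrix it is the orthogonal projection of
`E3` onto `T_x S²`. -/
def roundMetric (x : S2) (i j : Fin 3) : ℝ := (if i = j then 1 else 0) - x.1 i * x.1 j

/-- The volume form of the round metric, `ε_x(v, w) = det (x, v, w)`. -/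
def volForm (x : S2) (i j : Fin 3) : ℝ :=
  Matrix.det (Matrix.of ![fun k => x.1 k, Pi.single i 1, Pi.single j 1])

/-- The Levi-Civita covariant derivative `η_{i||k}` of a one-form: the tangential projection of
the ambient derivative along `S²`. -/
def covDeriv₁ (η : S2 → Fin 3 → ℝ) (x : S2) (i k : Fin 3) : ℝ :=
  ∑ p, roundMetric x i p * grad (fun y => η y p) x k

/-- The Levi-Civita covariant derivative `T_{ij||k}` of a rank two tensor field. -/
def covDeriv₂ (T : S2 → Fin 3 → Fin 3 → ℝ) (x : S2) (i j k : Fin 3) : ℝ :=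
  ∑ p, ∑ q, roundMetric x i p * roundMetric x j q * grad (fun y => T y p q) x k

/-- The covariant Hessian `f_{||ij}`. -/
def hess (f : S2 → ℝ) (x : S2) (i j : Fin 3) : ℝ := covDeriv₁ (grad f) x i j

/-- The Laplacian `D² f = f^{||A}_{||A}`. -/
def laplacian (f : S2 → ℝ) (x : S2) : ℝ := ∑ i, hess f x i i

/-- The divergence `T^{BC}_{||C}`. -/
def divergence (T : S2 → Fin 3 → Fin 3 → ℝ) (x : S2) (j : Fin 3) : ℝ :=
  ∑ k, covDeriv₂ T x j k k

/-- The integral over `S²` with respect to the standard volume (total area `4π`). -/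
def sphereIntegral (f : S2 → ℝ) : ℝ :=
  ∫ x, f x ∂((MeasureTheory.volume : MeasureTheory.Measure E3).toSphere)

/-- Linear combinations of the `l = 1` spherical harmonics, that is, restrictions to `S²` of
linear functions on `E3`. -/
def IsDipole (n : S2 → ℝ) : Prop := ∃ a : Fin 3 → ℝ, ∀ x : S2, n x = ∑ i, a i * x.1 i

/-- The tensor field with electric potential `c` and magnetic potential `b`,
`2 c_{||AB} - h_{AB} D² c + ε_{AC} b^{||C}_{||B} + ε_{BC} b^{||C}_{||A}`. -/
def tensorOfPotentials (c b : S2 → ℝ) (x : S2) (i j : Fin 3) : ℝ :=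
  2 * hess c x i j - roundMetric x i j * laplacian c x
    + ∑ k, volForm x i k * hess b x k j + ∑ k, volForm x j k * hess b x k i

/-- The Chruściel–Jezierski–Kijowski angular momentum
`-1/(8π) ∫ (3 N_A + 1/4 χ_{AB} χ^{BC}_{||C}) ε^{AD} n_{||D}`. -/
def angMomCJK (N : S2 → Fin 3 → ℝ) (χ : S2 → Fin 3 → Fin 3 → ℝ) (n : S2 → ℝ) : ℝ :=
  -(1 / (8 * Real.pi)) * sphereIntegral fun x =>
    ∑ i, ∑ l, (3 * N x i + 1 / 4 * ∑ j, χ x i j * divergence χ x j) * volForm x i l * grad n x l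

/-- The Compère–Nichols angular momentum with parameter `α`,
`J^{CJK} - (α - 1)/(32π) ∫ ε^{AD} n_{||D} χ_{AB} χ^{BC}_{||C}`. -/
def angMomCN (α : ℝ) (N : S2 → Fin 3 → ℝ) (χ : S2 → Fin 3 → Fin 3 → ℝ) (n : S2 → ℝ) : ℝ :=
  angMomCJK N χ n - (α - 1) / (32 * Real.pi) * sphereIntegral fun x =>
    ∑ i, ∑ l, ∑ j, volForm x i l * grad n x l * χ x i j * divergence χ x j

end NullInfinity

end

noncomputable section

open scoped Manifold ContDiff Topology Matrix
open MeasureTheory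

/-!
For `b = 0` the divergence of `χ` is the gradient of `F = D² c + 2 c`, the term `2 c` coming from
the Ricci curvature of `S²`. The vector field `Y^A = ε^{AD} n_{||D}` generates a rotation, so it is
a Killing field: `Y_{A||B}` is antisymmetric. Hence `Y^A χ_{AB}` has divergence `Y^A F_{||A}`, and
`Y^A χ_{AB} χ^{BC}_{||C} = Y^A χ_{AB} F^{||B}` is the divergence of
`F (Y^A χ_{AB} - (1 / 2) F Y_B)`, whose integral vanishes.

The divergence theorem on `S²` comes from integration by parts in `E3`: extend the one-form to be
constant along rays and multiply by a radial cutoff supported in an annulus. The derivative of the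
cutoff is radial, so its contraction with the tangential field vanishes, and in polar coordinates
what remains is the integral over `S²` times a positive radial factor.
-/

namespace NullInfinity

section RadialExtension

theorem radialExt_smul_coe (f : S2 → ℝ) (x : S2) {r : ℝ} (hr : 0 < r) :
    radialExt f (r • (x : E3)) = f x := by
  rw [radialExt, dif_neg (smul_ne_zero hr.ne' (ne_zero_of_mem_unit_sphere x))]
  congr 1
  ext1
  simp [norm_smul, abs_of_pos hr, smul_smul, hr.ne']

@[simp]
theorem radialExt_coe (f : S2 → ℝ) (x : S2) : radialExt f (x : E3) = f x := by
  simpa using radialExt_smul_coe f x one_pos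

@[simp]
theorem radialExt_zero (f : S2 → ℝ) : radialExt f 0 = 0 := by
  simp [radialExt]

theorem exists_smul_coe_eq {y : E3} (hy : y ≠ 0) : ∃ r : ℝ, 0 < r ∧ ∃ x : S2, r • (x : E3) = y :=
  ⟨‖y‖, norm_pos_iff.2 hy, ⟨‖y‖⁻¹ • y, by simp [norm_smul, hy]⟩, by simp [smul_smul, hy]⟩

theorem radialExt_smul (f : S2 → ℝ) (y : E3) {r : ℝ} (hr : 0 < r) :
    radialExt f (r • y) = radialExt f y := by
  rcases eq_or_ne y 0 with rfl | hy
  · simp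
  obtain ⟨s, hs, x, rfl⟩ := exists_smul_coe_eq hy
  rw [smul_smul, radialExt_smul_coe f x (mul_pos hr hs), radialExt_smul_coe f x hs]

theorem radialExt_const_eventuallyEq (a : ℝ) (x : S2) :
    radialExt (fun _ => a) =ᶠ[𝓝 (x : E3)] fun _ => a := by
  filter_upwards [isOpen_ne.mem_nhds (ne_zero_of_mem_unit_sphere x)] with y hy
  exact dif_neg hy

theorem radialExt_add (f g : S2 → ℝ) :
    radialExt (fun x => f x + g x) = radialExt f + radialExt g := by
  ext y
  by_cases hy : y = 0 <;> simp [radialExt, hy]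

theorem radialExt_mul (f g : S2 → ℝ) :
    radialExt (fun x => f x * g x) = radialExt f * radialExt g := by
  ext y
  by_cases hy : y = 0 <;> simp [radialExt, hy]

theorem radialExt_coord (i : Fin 3) :
    radialExt (fun x => x.1 i) = fun y => ‖y‖⁻¹ * y i := by
  ext y
  by_cases hy : y = 0 <;> simp [radialExt, hy]

theorem radialExt_grad (f : S2 → ℝ) (k : Fin 3) :
    radialExt (fun x => grad f x k) =
      fun y => ‖y‖ * fderiv ℝ (radialExt f) y (EuclideanSpace.single k 1) := by
  ext y
  rcases eq_or_ne y 0 with rfl | hy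
  · simp
  obtain ⟨r, hr, x, rfl⟩ := exists_smul_coe_eq hy
  have hscale : (radialExt f <| r • ·) = radialExt f := funext fun z => radialExt_smul f z hr
  have hderiv := fderiv_comp_smul (𝕜 := ℝ) (f := radialExt f) (x := (x : E3)) r
  rw [hscale] at hderiv
  simp [radialExt_smul_coe _ x hr, grad, hderiv, norm_smul, abs_of_pos hr]

end RadialExtension

section Smooth

variable {f g : S2 → ℝ}

theorem IsSmooth.contMDiffOn_radialExt (hf : IsSmooth f) :
    ContMDiffOn 𝓘(ℝ, E3) 𝓘(ℝ, ℝ) ∞ (radialExt f) {0}ᶜ := by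
  intro y hy
  let U : TopologicalSpace.Opens E3 := ⟨{0}ᶜ, isOpen_compl_singleton⟩
  have hU (z : U) : (z : E3) ≠ 0 := z.2
  have hproj : ContMDiff 𝓘(ℝ, E3) 𝓘(ℝ, E3) ∞ fun z : U => ‖(z : E3)‖⁻¹ • (z : E3) := fun z =>
    contMDiffAt_subtype_iff.2
      (((contDiffAt_norm ℝ (hU z)).inv (norm_ne_zero_iff.2 (hU z))).smul
        contDiffAt_id).contMDiffAt
  have : Fact (Module.finrank ℝ E3 = 2 + 1) := ⟨finrank_euclideanSpace_fin⟩
  have hcomp := hf.comp (hproj.codRestrict_sphere (n := 2) fun z => by simp [norm_smul, hU z])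
  refine ContMDiffAt.contMDiffWithinAt (contMDiffAt_subtype_iff (U := U) (x := ⟨y, hy⟩) |>.1 ?_)
  convert hcomp ⟨y, hy⟩ using 1
  ext z
  exact dif_neg (hU z)

theorem isSmooth_iff_contDiffOn_radialExt :
    IsSmooth f ↔ ContDiffOn ℝ ∞ (radialExt f) {0}ᶜ := by
  refine ⟨fun hf => hf.contMDiffOn_radialExt.contDiffOn, fun hf => ?_⟩
  have : Fact (Module.finrank ℝ E3 = 2 + 1) := ⟨finrank_euclideanSpace_fin⟩
  have hcomp := hf.contMDiffOn.comp_contMDiff (contMDiff_coe_sphere (n := 2))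
    fun x : S2 => ne_zero_of_mem_unit_sphere x
  simpa only [IsSmooth, Function.comp_def, radialExt_coe] using hcomp

theorem IsSmooth.contDiffAt_radialExt (hf : IsSmooth f) {y : E3} (hy : y ≠ 0) :
    ContDiffAt ℝ ∞ (radialExt f) y :=
  (isSmooth_iff_contDiffOn_radialExt.1 hf).contDiffAt (isOpen_ne.mem_nhds hy)

theorem IsSmooth.differentiableAt_radialExt (hf : IsSmooth f) (x : S2) :
    DifferentiableAt ℝ (radialExt f) x :=
  (hf.contDiffAt_radialExt (ne_zero_of_mem_unit_sphere x)).differentiableAt (by simp)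

theorem isSmooth_const (a : ℝ) : IsSmooth fun _ => a :=
  contMDiff_const

theorem IsSmooth.add (hf : IsSmooth f) (hg : IsSmooth g) : IsSmooth fun x => f x + g x :=
  ContMDiff.add hf hg

theorem IsSmooth.mul (hf : IsSmooth f) (hg : IsSmooth g) : IsSmooth fun x => f x * g x :=
  ContMDiff.mul hf hg

theorem IsSmooth.const_mul (a : ℝ) (hf : IsSmooth f) : IsSmooth fun x => a * f x :=
  (isSmooth_const a).mul hf

theorem IsSmooth.sub (hf : IsSmooth f) (hg : IsSmooth g) : IsSmooth fun x => f x - g x :=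
  ContMDiff.sub hf hg

theorem isSmooth_sum {ι : Type*} (s : Finset ι) {f : ι → S2 → ℝ}
    (hf : ∀ i ∈ s, IsSmooth (f i)) : IsSmooth fun x => ∑ i ∈ s, f i x :=
  contMDiff_finsetSum hf

theorem isSmooth_coord (i : Fin 3) : IsSmooth fun x => x.1 i := by
  have : Fact (Module.finrank ℝ E3 = 2 + 1) := ⟨finrank_euclideanSpace_fin⟩
  exact (EuclideanSpace.proj (𝕜 := ℝ) i).contDiff.contMDiff.comp (contMDiff_coe_sphere (n := 2))

theorem IsSmooth.contDiffAt_fderiv_radialExt (hf : IsSmooth f) {y : E3} (hy : y ≠ 0) :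
    ContDiffAt ℝ ∞ (fderiv ℝ (radialExt f)) y :=
  (hf.contDiffAt_radialExt hy).fderiv_right (by simp)

theorem IsSmooth.grad (hf : IsSmooth f) (k : Fin 3) : IsSmooth fun x => grad f x k := by
  rw [isSmooth_iff_contDiffOn_radialExt, radialExt_grad]
  exact fun y hy => ((contDiffAt_norm ℝ hy).mul
    ((hf.contDiffAt_fderiv_radialExt hy).clm_apply contDiffAt_const)).contDiffWithinAt

end Smooth

section Gradient

variable {f g : S2 → ℝ}

theorem grad_const (a : ℝ) (x : S2) (k : Fin 3) : grad (fun _ => a) x k = 0 := by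
  simp [grad, (radialExt_const_eventuallyEq a x).fderiv_eq]

theorem grad_add (hf : IsSmooth f) (hg : IsSmooth g) (x : S2) (k : Fin 3) :
    grad (fun y => f y + g y) x k = grad f x k + grad g x k := by
  rw [grad, radialExt_add,
    fderiv_add (hf.differentiableAt_radialExt x) (hg.differentiableAt_radialExt x)]
  rfl

theorem grad_mul (hf : IsSmooth f) (hg : IsSmooth g) (x : S2) (k : Fin 3) :
    grad (fun y => f y * g y) x k = f x * grad g x k + g x * grad f x k := by
  rw [grad, radialExt_mul,
    fderiv_mul (hf.differentiableAt_radialExt x) (hg.differentiableAt_radialExt x)]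
  simp [grad]

theorem grad_const_mul (a : ℝ) (hf : IsSmooth f) (x : S2) (k : Fin 3) :
    grad (fun y => a * f y) x k = a * grad f x k := by
  simp [grad_mul (isSmooth_const a) hf, grad_const]

theorem grad_sub (hf : IsSmooth f) (hg : IsSmooth g) (x : S2) (k : Fin 3) :
    grad (fun y => f y - g y) x k = grad f x k - grad g x k := by
  have h : (fun y => f y - g y) = fun y => f y + -1 * g y := funext fun y => by ring
  rw [h, grad_add hf (hg.const_mul _), grad_const_mul _ hg]
  ring

theorem grad_sum {ι : Type*} (s : Finset ι) {f : ι → S2 → ℝ} (hf : ∀ i ∈ s, IsSmooth (f i))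
    (x : S2) (k : Fin 3) : grad (fun y => ∑ i ∈ s, f i y) x k = ∑ i ∈ s, grad (f i) x k := by
  induction s using Finset.cons_induction with
  | empty => simp [grad_const]
  | cons i s hi ih =>
    rw [Finset.forall_mem_cons] at hf
    simp_rw [Finset.sum_cons]
    rw [grad_add hf.1 (isSmooth_sum s hf.2), ih hf.2]

theorem hasFDerivAt_norm {E : Type*} [NormedAddCommGroup E] [InnerProductSpace ℝ E] {x : E}
    (hx : x ≠ 0) : HasFDerivAt (fun y : E => ‖y‖) (‖x‖⁻¹ • innerSL ℝ x) x := by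
  have h := (hasStrictFDerivAt_norm_sq x).hasFDerivAt.sqrt (pow_ne_zero 2 (norm_ne_zero_iff.2 hx))
  simp only [Real.sqrt_sq (norm_nonneg _)] at h
  convert h using 1
  ext v
  simp only [smul_apply, coe_innerSL_apply, smul_eq_mul, one_div, mul_inv_rev, nsmul_eq_mul,
    Nat.cast_ofNat]
  ring

theorem grad_coord (x : S2) (i k : Fin 3) : grad (fun y => y.1 i) x k = roundMetric x i k := by
  have hx := ne_zero_of_mem_unit_sphere x
  have hinv := (hasDerivAt_inv (norm_ne_zero_iff.2 hx)).comp_hasFDerivAt (x : E3)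
    (hasFDerivAt_norm hx)
  have hprod := hinv.mul (EuclideanSpace.proj (𝕜 := ℝ) (ι := Fin 3) i).hasFDerivAt
  rw [grad, radialExt_coord]
  refine (congrArg (fun L : E3 →L[ℝ] ℝ => L (EuclideanSpace.single k 1)) hprod.fderiv).trans ?_
  simp [roundMetric, EuclideanSpace.inner_single_right, sub_eq_add_neg]

theorem sum_coord_mul_grad (hf : IsSmooth f) (x : S2) : ∑ k, x.1 k * grad f x k = 0 := by
  have hcoord : fderiv ℝ (radialExt f) x x = ∑ k, x.1 k * grad f x k := by
    have h := congrArg (fderiv ℝ (radialExt f) (x : E3))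
      ((EuclideanSpace.basisFun (Fin 3) ℝ).sum_repr x)
    simpa [grad] using h.symm
  have hline : HasDerivAt (fun t : ℝ => t • (x : E3)) (x : E3) 1 := by
    simpa using (hasDerivAt_id (1 : ℝ)).smul_const (x : E3)
  have hray : HasDerivAt (fun t : ℝ => radialExt f (t • (x : E3)))
      (fderiv ℝ (radialExt f) x x) 1 := by
    have hdiff : HasFDerivAt (radialExt f) (fderiv ℝ (radialExt f) x) ((1 : ℝ) • (x : E3)) := by
      simpa using (hf.differentiableAt_radialExt x).hasFDerivAt
    exact hdiff.comp_hasDerivAt (1 : ℝ) hline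
  have hconst : (fun t : ℝ => radialExt f (t • (x : E3))) =ᶠ[𝓝 1] fun _ => f x := by
    filter_upwards [lt_mem_nhds one_pos] with t ht using radialExt_smul_coe f x ht
  rw [← hcoord]
  exact hray.unique (hconst.hasDerivAt_iff.2 (hasDerivAt_const _ _))

theorem grad_grad (hf : IsSmooth f) (x : S2) (i j : Fin 3) :
    grad (fun y => grad f y i) x j = x.1 j * grad f x i +
      fderiv ℝ (fderiv ℝ (radialExt f)) x (EuclideanSpace.single j 1)
        (EuclideanSpace.single i 1) := by
  have hx := ne_zero_of_mem_unit_sphere x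
  have hsecond := ((hf.contDiffAt_fderiv_radialExt hx).differentiableAt (by simp)).hasFDerivAt
  have hprod := (hasFDerivAt_norm hx).mul
    (hsecond.clm_apply (hasFDerivAt_const (EuclideanSpace.single i (1 : ℝ)) (x : E3)))
  rw [grad, radialExt_grad]
  refine (congrArg (fun L : E3 →L[ℝ] ℝ => L (EuclideanSpace.single j 1)) hprod.fderiv).trans ?_
  simp only [norm_eq_of_mem_sphere, ContinuousLinearMap.comp_zero, zero_add, one_smul, inv_one,
    add_apply, ContinuousLinearMap.flip_apply, smul_apply, coe_innerSL_apply,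
    EuclideanSpace.inner_single_right, Real.ringHom_apply, one_mul, smul_eq_mul, grad]
  ring

end Gradient

section Tensor

theorem sum_coord_sq (x : S2) : ∑ i, x.1 i * x.1 i = 1 := by
  simpa [sq] using (EuclideanSpace.real_norm_sq_eq (x : E3)).symm

theorem roundMetric_comm (x : S2) (i j : Fin 3) : roundMetric x i j = roundMetric x j i := by
  simp [roundMetric, eq_comm, mul_comm]

theorem sum_roundMetric_mul (x : S2) (i : Fin 3) (v : Fin 3 → ℝ) :
    ∑ p, roundMetric x i p * v p = v i - x.1 i * ∑ p, x.1 p * v p := by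
  simp [roundMetric, sub_mul, Finset.sum_sub_distrib, Finset.mul_sum, mul_assoc]

theorem sum_roundMetric_mul_of_tangential {x : S2} {v : Fin 3 → ℝ} (hv : ∑ p, x.1 p * v p = 0)
    (i : Fin 3) : ∑ p, roundMetric x i p * v p = v i := by
  simp [sum_roundMetric_mul, hv]

theorem sum_sum_roundMetric_mul_mul_of_tangential {x : S2} {v : Fin 3 → ℝ}
    (hv : ∑ p, x.1 p * v p = 0) (w : Fin 3 → ℝ) :
    ∑ i, (∑ p, roundMetric x i p * w p) * v i = ∑ p, w p * v p := by
  simp only [sum_roundMetric_mul, sub_mul, Finset.sum_sub_distrib, mul_right_comm (x.1 _),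
    ← Finset.sum_mul, hv, zero_mul, sub_zero]

theorem sum_roundMetric_mul_coord (x : S2) (i : Fin 3) : ∑ p, roundMetric x i p * x.1 p = 0 := by
  simp [sum_roundMetric_mul, sum_coord_sq]

theorem sum_roundMetric_self (x : S2) : ∑ p, roundMetric x p p = 2 := by
  simp only [roundMetric, Finset.sum_sub_distrib, sum_coord_sq]
  norm_num

theorem isSmooth_roundMetric (i j : Fin 3) : IsSmooth fun x => roundMetric x i j :=
  (isSmooth_const _).sub ((isSmooth_coord i).mul (isSmooth_coord j))

/-- Smooth tensor fields `T_{AB}` of rank two on `S²`, in the Cartesian encoding of one-forms. -/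
structure IsTensorField (T : S2 → Fin 3 → Fin 3 → ℝ) : Prop where
  smooth : ∀ i j, IsSmooth fun x => T x i j
  tangential_left : ∀ (x : S2) (j : Fin 3), ∑ i, x.1 i * T x i j = 0
  tangential_right : ∀ (x : S2) (i : Fin 3), ∑ j, x.1 j * T x i j = 0

theorem IsSymmTracelessTensor.isTensorField {T : S2 → Fin 3 → Fin 3 → ℝ}
    (hT : IsSymmTracelessTensor T) : IsTensorField T where
  smooth := hT.smooth
  tangential_left := hT.tangential
  tangential_right x i := by simpa only [hT.symm x i] using hT.tangential x i

theorem IsOneForm.smul {f : S2 → ℝ} {η : S2 → Fin 3 → ℝ} (hf : IsSmooth f) (hη : IsOneForm η) :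
    IsOneForm fun x i => f x * η x i where
  smooth i := hf.mul (hη.smooth i)
  tangential x := by simp only [mul_left_comm _ (f x), ← Finset.mul_sum, hη.tangential, mul_zero]

theorem IsOneForm.sub {η θ : S2 → Fin 3 → ℝ} (hη : IsOneForm η) (hθ : IsOneForm θ) :
    IsOneForm fun x i => η x i - θ x i where
  smooth i := (hη.smooth i).sub (hθ.smooth i)
  tangential x := by
    simp only [mul_sub, Finset.sum_sub_distrib, hη.tangential, hθ.tangential, sub_zero]

theorem IsTensorField.contract {η : S2 → Fin 3 → ℝ} {T : S2 → Fin 3 → Fin 3 → ℝ}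
    (hT : IsTensorField T) (hη : IsOneForm η) : IsOneForm fun x j => ∑ i, η x i * T x i j where
  smooth j := isSmooth_sum _ fun i _ => (hη.smooth i).mul (hT.smooth i j)
  tangential x := by
    simp only [Finset.mul_sum]
    rw [Finset.sum_comm]
    simp only [mul_left_comm _ (η x _), ← Finset.mul_sum, hT.tangential_right, mul_zero,
      Finset.sum_const_zero]

theorem sum_sum_mul_eq_zero_of_antisymm_of_symm {ι : Type*} [Fintype ι] {A T : ι → ι → ℝ}
    (hA : ∀ i j, A i j = -A j i) (hT : ∀ i j, T i j = T j i) :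
    ∑ i, ∑ j, A i j * T i j = 0 := by
  have hswap : ∑ i, ∑ j, A i j * T i j = -∑ i, ∑ j, A i j * T i j := by
    conv_lhs => rw [Finset.sum_comm]
    simp only [← Finset.sum_neg_distrib, ← neg_mul, ← hA, hT]
  linarith

end Tensor

section Divergence

variable {f : S2 → ℝ} {η θ : S2 → Fin 3 → ℝ} {T U : S2 → Fin 3 → Fin 3 → ℝ}

/-- The divergence `η^A_{||A}` of a one-form. -/
def divergence₁ (η : S2 → Fin 3 → ℝ) (x : S2) : ℝ := ∑ k, covDeriv₁ η x k k

theorem divergence₁_eq_sum_grad (hη : ∀ i, IsSmooth fun x => η x i) (x : S2) :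
    divergence₁ η x = ∑ p, grad (fun y => η y p) x p := by
  simp only [divergence₁, covDeriv₁]
  rw [Finset.sum_comm]
  refine Finset.sum_congr rfl fun p _ => ?_
  simp only [roundMetric_comm x _ p,
    sum_roundMetric_mul_of_tangential (sum_coord_mul_grad (hη p) x)]

theorem divergence_eq_sum_roundMetric_mul (hT : ∀ i j, IsSmooth fun x => T x i j) (x : S2)
    (j : Fin 3) :
    divergence T x j = ∑ p, roundMetric x j p * ∑ q, grad (fun y => T y p q) x q := by
  simp only [divergence, covDeriv₂]
  rw [Finset.sum_comm]
  refine Finset.sum_congr rfl fun p _ => ?_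
  rw [Finset.sum_comm, Finset.mul_sum]
  refine Finset.sum_congr rfl fun q _ => ?_
  simp only [mul_assoc, ← Finset.mul_sum, roundMetric_comm x _ q,
    sum_roundMetric_mul_of_tangential (sum_coord_mul_grad (hT p q) x)]

theorem divergence₁_sub (hη : ∀ i, IsSmooth fun x => η x i) (hθ : ∀ i, IsSmooth fun x => θ x i)
    (x : S2) : divergence₁ (fun y i => η y i - θ y i) x = divergence₁ η x - divergence₁ θ x := by
  rw [divergence₁_eq_sum_grad fun i => (hη i).sub (hθ i), divergence₁_eq_sum_grad hη,
    divergence₁_eq_sum_grad hθ, ← Finset.sum_sub_distrib]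
  exact Finset.sum_congr rfl fun i _ => grad_sub (hη i) (hθ i) x i

theorem divergence₁_smul (hf : IsSmooth f) (hη : ∀ i, IsSmooth fun x => η x i) (x : S2) :
    divergence₁ (fun y i => f y * η y i) x =
      f x * divergence₁ η x + ∑ i, η x i * grad f x i := by
  rw [divergence₁_eq_sum_grad fun i => hf.mul (hη i), divergence₁_eq_sum_grad hη, Finset.mul_sum,
    ← Finset.sum_add_distrib]
  exact Finset.sum_congr rfl fun i _ => grad_mul hf (hη i) x i

theorem divergence₁_contract (hT : IsTensorField T) (hη : IsOneForm η) (x : S2) :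
    divergence₁ (fun y j => ∑ i, η y i * T y i j) x =
      ∑ i, ∑ j, covDeriv₁ η x i j * T x i j + ∑ i, η x i * divergence T x i := by
  have hleibniz (j : Fin 3) : grad (fun y => ∑ i, η y i * T y i j) x j =
      ∑ i, (η x i * grad (fun y => T y i j) x j + T x i j * grad (fun y => η y i) x j) := by
    rw [grad_sum _ fun i _ => (hη.smooth i).mul (hT.smooth i j)]
    exact Finset.sum_congr rfl fun i _ => grad_mul (hη.smooth i) (hT.smooth i j) x j
  have hcov (j : Fin 3) : ∑ i, covDeriv₁ η x i j * T x i j =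
      ∑ i, T x i j * grad (fun y => η y i) x j := by
    simp only [covDeriv₁, sum_sum_roundMetric_mul_mul_of_tangential (hT.tangential_left x j),
      mul_comm (T x _ j)]
  have hdiv : ∑ i, η x i * divergence T x i =
      ∑ i, η x i * ∑ j, grad (fun y => T y i j) x j := by
    simp only [divergence_eq_sum_roundMetric_mul hT.smooth, mul_comm (η x _),
      sum_sum_roundMetric_mul_mul_of_tangential (hη.tangential x)]
  rw [divergence₁_eq_sum_grad (hT.contract hη).smooth, Finset.sum_comm, hdiv]
  simp only [hleibniz, hcov, Finset.sum_add_distrib, Finset.mul_sum]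
  rw [add_comm, add_right_inj, Finset.sum_comm]

theorem divergence_sub (hT : ∀ i j, IsSmooth fun x => T x i j)
    (hU : ∀ i j, IsSmooth fun x => U x i j) (x : S2) (j : Fin 3) :
    divergence (fun y p q => T y p q - U y p q) x j = divergence T x j - divergence U x j := by
  simp only [divergence_eq_sum_roundMetric_mul fun p q => (hT p q).sub (hU p q),
    divergence_eq_sum_roundMetric_mul hT, divergence_eq_sum_roundMetric_mul hU,
    grad_sub (hT _ _) (hU _ _), Finset.sum_sub_distrib, mul_sub]

theorem divergence_const_mul (a : ℝ) (hT : ∀ i j, IsSmooth fun x => T x i j) (x : S2)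
    (j : Fin 3) : divergence (fun y p q => a * T y p q) x j = a * divergence T x j := by
  simp only [divergence_eq_sum_roundMetric_mul fun p q => (hT p q).const_mul a,
    divergence_eq_sum_roundMetric_mul hT, grad_const_mul a (hT _ _), ← Finset.mul_sum,
    mul_left_comm _ a]

theorem divergence_roundMetric_mul (hf : IsSmooth f) (x : S2) (j : Fin 3) :
    divergence (fun y p q => roundMetric y p q * f y) x j = grad f x j := by
  have hmetric (p : Fin 3) : ∑ q, grad (fun y => roundMetric y p q) x q = -(2 * x.1 p) := by
    simp only [roundMetric]
    simp only [grad_sub (isSmooth_const _) ((isSmooth_coord p).mul (isSmooth_coord _)),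
      grad_const, grad_mul (isSmooth_coord p) (isSmooth_coord _), grad_coord, zero_sub,
      Finset.sum_neg_distrib, Finset.sum_add_distrib, ← Finset.mul_sum, sum_roundMetric_self,
      mul_comm (x.1 _) (roundMetric x p _), sum_roundMetric_mul_coord, add_zero]
    ring
  have hsum (p : Fin 3) : ∑ q, grad (fun y => roundMetric y p q * f y) x q =
      grad f x p - 2 * f x * x.1 p := by
    simp only [grad_mul (isSmooth_roundMetric p _) hf, Finset.sum_add_distrib, ← Finset.mul_sum,
      hmetric, sum_roundMetric_mul_of_tangential (sum_coord_mul_grad hf x)]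
    ring
  rw [divergence_eq_sum_roundMetric_mul fun p q => (isSmooth_roundMetric p q).mul hf]
  simp only [hsum, mul_sub, Finset.sum_sub_distrib, mul_left_comm _ (2 * f x), ← Finset.mul_sum,
    sum_roundMetric_mul_of_tangential (sum_coord_mul_grad hf x), sum_roundMetric_mul_coord,
    mul_zero, sub_zero]

end Divergence

section Hessian

variable {f : S2 → ℝ}

theorem sum_coord_mul_grad_grad (hf : IsSmooth f) (x : S2) (j : Fin 3) :
    ∑ p, x.1 p * grad (fun y => grad f y p) x j = -grad f x j := by
  have h : grad (fun y => ∑ p, y.1 p * grad f y p) x j = 0 := by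
    simp only [sum_coord_mul_grad hf, grad_const]
  rw [grad_sum _ fun p _ => (isSmooth_coord p).mul (hf.grad p)] at h
  simp only [grad_mul (isSmooth_coord _) (hf.grad _), grad_coord, Finset.sum_add_distrib,
    mul_comm (grad f x _), roundMetric_comm x _ j,
    sum_roundMetric_mul_of_tangential (sum_coord_mul_grad hf x)] at h
  linarith

theorem hess_eq (hf : IsSmooth f) (x : S2) (i j : Fin 3) :
    hess f x i j = grad (fun y => grad f y i) x j + x.1 i * grad f x j := by
  rw [hess, covDeriv₁, sum_roundMetric_mul, sum_coord_mul_grad_grad hf]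
  ring

theorem hess_comm (hf : IsSmooth f) (x : S2) (i j : Fin 3) : hess f x i j = hess f x j i := by
  have hsymm : IsSymmSndFDerivAt ℝ (radialExt f) (x : E3) :=
    (hf.contDiffAt_radialExt (ne_zero_of_mem_unit_sphere x)).isSymmSndFDerivAt
      (by simpa using (ENat.LEInfty.out : (2 : WithTop ℕ∞) ≤ ∞))
  rw [hess_eq hf, hess_eq hf, grad_grad hf, grad_grad hf, hsymm.eq]
  ring

theorem laplacian_eq_sum_grad_grad (hf : IsSmooth f) (x : S2) :
    laplacian f x = ∑ i, grad (fun y => grad f y i) x i := by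
  simp only [laplacian, hess_eq hf, Finset.sum_add_distrib, sum_coord_mul_grad hf, add_zero]

theorem IsSmooth.hess (hf : IsSmooth f) (i j : Fin 3) : IsSmooth fun x => hess f x i j := by
  simp only [hess_eq hf]
  exact ((hf.grad i).grad j).add ((isSmooth_coord i).mul (hf.grad j))

theorem IsSmooth.laplacian (hf : IsSmooth f) : IsSmooth (laplacian f) :=
  isSmooth_sum _ fun i _ => hf.hess i i

theorem grad_grad_comm (hf : IsSmooth f) (x : S2) (i j : Fin 3) :
    grad (fun y => grad f y i) x j =
      grad (fun y => grad f y j) x i + x.1 j * grad f x i - x.1 i * grad f x j := by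
  linarith [hess_eq hf x i j, hess_eq hf x j i, hess_comm hf x i j]

theorem sum_grad_hess (hf : IsSmooth f) (x : S2) (p : Fin 3) :
    ∑ q, grad (fun y => hess f y p q) x q =
      grad (laplacian f) x p + grad f x p - laplacian f x * x.1 p := by
  have hlap : grad (laplacian f) x p =
      ∑ q, grad (fun y => grad (fun z => grad f z q) y q) x p := by
    rw [funext (laplacian_eq_sum_grad_grad hf), grad_sum _ fun q _ => (hf.grad q).grad q]
  simp only [hess_comm hf _ p, hess_eq hf]
  simp only [grad_add ((hf.grad _).grad p) ((isSmooth_coord _).mul (hf.grad p)),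
    grad_mul (isSmooth_coord _) (hf.grad p), grad_coord, grad_grad_comm (hf.grad _) x p,
    Finset.sum_add_distrib, Finset.sum_sub_distrib, ← Finset.mul_sum, ← hlap,
    sum_coord_mul_grad_grad hf, sum_coord_mul_grad (hf.grad p), sum_roundMetric_self,
    ← laplacian_eq_sum_grad_grad hf]
  ring

-- Commuting the derivatives costs the Ricci curvature of `S²`, which is the metric itself.
theorem divergence_hess (hf : IsSmooth f) (x : S2) (j : Fin 3) :
    divergence (hess f) x j = grad (laplacian f) x j + grad f x j := by
  rw [divergence_eq_sum_roundMetric_mul hf.hess]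
  simp only [sum_grad_hess hf, mul_sub, mul_add, Finset.sum_sub_distrib, Finset.sum_add_distrib,
    mul_left_comm _ (laplacian f x), ← Finset.mul_sum, sum_roundMetric_mul_coord,
    sum_roundMetric_mul_of_tangential (sum_coord_mul_grad hf x),
    sum_roundMetric_mul_of_tangential (sum_coord_mul_grad hf.laplacian x), mul_zero, sub_zero]

theorem tensorOfPotentials_zero_right (c : S2 → ℝ) :
    tensorOfPotentials c 0 = fun x i j =>
      2 * hess c x i j - roundMetric x i j * laplacian c x := by
  have hgrad : grad 0 = 0 := funext fun x => funext fun k => grad_const 0 x k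
  have hhess : hess 0 = 0 := by
    funext x i j
    simp only [hess, covDeriv₁, hgrad, Pi.zero_apply, grad_const, mul_zero, Finset.sum_const_zero]
  funext x i j
  simp only [tensorOfPotentials, hhess, Pi.zero_apply, mul_zero, Finset.sum_const_zero, add_zero]

theorem divergence_tensorOfPotentials_zero_right {c : S2 → ℝ} (hc : IsSmooth c) (x : S2)
    (j : Fin 3) :
    divergence (tensorOfPotentials c 0) x j = grad (fun y => laplacian c y + 2 * c y) x j := by
  rw [tensorOfPotentials_zero_right,
    divergence_sub (fun p q => (hc.hess p q).const_mul 2)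
      (fun p q => (isSmooth_roundMetric p q).mul hc.laplacian),
    divergence_const_mul 2 hc.hess, divergence_hess hc, divergence_roundMetric_mul hc.laplacian,
    grad_add hc.laplacian (hc.const_mul 2), grad_const_mul 2 hc]
  ring

end Hessian

section Integration

theorem integral_eq_integral_toSphere_prod {E F : Type*} [NormedAddCommGroup E] [NormedSpace ℝ E]
    [FiniteDimensional ℝ E] [Nontrivial E] [MeasurableSpace E] [BorelSpace E]
    [NormedAddCommGroup F] [NormedSpace ℝ F] (μ : Measure E) [μ.IsAddHaarMeasure] (g : E → F) :
    ∫ y, g y ∂μ = ∫ p : Metric.sphere (0 : E) 1 × Set.Ioi (0 : ℝ), g (p.2.1 • p.1.1)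
      ∂(μ.toSphere.prod (.volumeIoiPow (Module.finrank ℝ E - 1))) := by
  rw [← μ.measurePreserving_homeomorphUnitSphereProd.integral_comp
    (Homeomorph.measurableEmbedding _) fun p => g (p.2.1 • p.1.1)]
  simp only [← homeomorphUnitSphereProd_symm_apply_coe, Homeomorph.symm_apply_apply]
  rw [integral_subtype_comap (measurableSet_singleton _).compl g, restrict_compl_singleton]

theorem integral_radial_mul_radialExt (w : ℝ → ℝ) (f : S2 → ℝ) :
    ∫ y : E3, w ‖y‖ * radialExt f y =
      sphereIntegral f * ∫ r : Set.Ioi (0 : ℝ), w r ∂Measure.volumeIoiPow 2 := by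
  have hpolar (p : S2 × Set.Ioi (0 : ℝ)) :
      w ‖p.2.1 • p.1.1‖ * radialExt f (p.2.1 • p.1.1) = f p.1 * w p.2 := by
    rw [radialExt_smul_coe f p.1 p.2.2, mul_comm]
    simp [norm_smul, abs_of_pos (Set.mem_Ioi.1 p.2.2)]
  rw [integral_eq_integral_toSphere_prod, finrank_euclideanSpace_fin]
  simp only [hpolar]
  exact integral_prod_mul f fun r : Set.Ioi (0 : ℝ) => w r

theorem continuous_mul_of_tsupport_subset {X : Type*} [TopologicalSpace X] {ρ g : X → ℝ}
    {U : Set X} (hU : IsOpen U) (hρ : Continuous ρ) (hsub : tsupport ρ ⊆ U)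
    (hg : ContinuousOn g U) : Continuous fun y => ρ y * g y :=
  (hρ.continuousOn.mul hg).continuous_of_tsupport_subset hU
    ((closure_mono (Function.support_mul_subset_left ρ g)).trans hsub)

theorem integrable_mul_of_tsupport_subset {X : Type*} [TopologicalSpace X] [MeasurableSpace X]
    [OpensMeasurableSpace X] {μ : Measure X} [IsFiniteMeasureOnCompacts μ] {ρ g : X → ℝ}
    {U : Set X} (hU : IsOpen U) (hρ : Continuous ρ) (hcompact : HasCompactSupport ρ)
    (hsub : tsupport ρ ⊆ U) (hg : ContinuousOn g U) : Integrable (fun y => ρ y * g y) μ :=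
  (continuous_mul_of_tsupport_subset hU hρ hsub hg).integrable_of_hasCompactSupport
    hcompact.mul_right

/-- A bump function of one real variable, supported in `[1, 3]`. -/
def annulusBump : ContDiffBump (2 : ℝ) := ⟨1 / 2, 1, by norm_num, by norm_num⟩

section Cutoff

variable {E : Type*} [NormedAddCommGroup E]

/-- A radial cutoff function supported in the annulus `1 ≤ ‖y‖ ^ 2 ≤ 3`; the norm is squared to
make the argument of the bump smooth at the origin as well. -/
def annularCutoff (y : E) : ℝ := annulusBump (‖y‖ ^ 2)

theorem tsupport_annularCutoff_subset :
    tsupport (annularCutoff : E → ℝ) ⊆ (fun y => ‖y‖ ^ 2) ⁻¹' Metric.closedBall 2 1 := by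
  refine (tsupport_comp_subset_preimage annulusBump (f := fun y : E => ‖y‖ ^ 2)
    (by fun_prop)).trans ?_
  rw [annulusBump.tsupport_eq]
  rfl

theorem tsupport_annularCutoff_subset_compl_zero :
    tsupport (annularCutoff : E → ℝ) ⊆ {0}ᶜ := by
  rintro y hy rfl
  have h := tsupport_annularCutoff_subset hy
  norm_num [Real.dist_eq] at h

theorem hasCompactSupport_annularCutoff [ProperSpace E] :
    HasCompactSupport (annularCutoff : E → ℝ) := by
  refine (isCompact_closedBall (0 : E) 2).of_isClosed_subset (isClosed_tsupport _) fun y hy => ?_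
  have h := tsupport_annularCutoff_subset hy
  simp only [Set.mem_preimage, Metric.mem_closedBall, Real.dist_eq, abs_le] at h
  rw [mem_closedBall_zero_iff]
  nlinarith

variable [InnerProductSpace ℝ E]

theorem contDiff_annularCutoff : ContDiff ℝ ∞ (annularCutoff : E → ℝ) :=
  annulusBump.contDiff.comp (contDiff_norm_sq ℝ)

theorem fderiv_annularCutoff (y v : E) :
    fderiv ℝ annularCutoff y v = 2 * deriv annulusBump (‖y‖ ^ 2) * inner ℝ y v := by
  have hbump : HasDerivAt annulusBump (deriv annulusBump (‖y‖ ^ 2)) (‖y‖ ^ 2) :=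
    ((annulusBump.contDiff (n := 1)).differentiable (by simp) _).hasDerivAt
  have hcomp := hbump.comp_hasFDerivAt y (hasStrictFDerivAt_norm_sq y).hasFDerivAt
  refine (congrArg (fun L : E →L[ℝ] ℝ => L v) hcomp.fderiv).trans ?_
  simp only [smul_apply, coe_innerSL_apply, nsmul_eq_mul, Nat.cast_ofNat, smul_eq_mul]
  ring

end Cutoff

theorem integral_annulusBump_sq_mul_inv_ne_zero :
    ∫ r : Set.Ioi (0 : ℝ), annulusBump (r.1 ^ 2) * r.1⁻¹ ∂Measure.volumeIoiPow 2 ≠ 0 := by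
  have hcont : Continuous fun y : E3 => annularCutoff y * ‖y‖⁻¹ :=
    continuous_mul_of_tsupport_subset isOpen_compl_singleton contDiff_annularCutoff.continuous
      tsupport_annularCutoff_subset_compl_zero
      (continuous_norm.continuousOn.inv₀ fun y hy => norm_ne_zero_iff.2 hy)
  have hpos : 0 < ∫ y : E3, annularCutoff y * ‖y‖⁻¹ := by
    refine hcont.integral_pos_of_hasCompactSupport_nonneg_nonzero
      hasCompactSupport_annularCutoff.mul_right
      (fun y => mul_nonneg annulusBump.nonneg (inv_nonneg.2 (norm_nonneg y)))
      (x := EuclideanSpace.single 0 √2) ?_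
    have hcenter : annulusBump (2 : ℝ) = 1 :=
      annulusBump.one_of_mem_closedBall (by simp [annulusBump])
    simp [annularCutoff, hcenter]
  have hpolar := integral_radial_mul_radialExt (fun r => annulusBump (r ^ 2) * r⁻¹) fun _ => 1
  have hone : (fun y : E3 => annulusBump (‖y‖ ^ 2) * ‖y‖⁻¹ * radialExt (fun _ => 1) y) =
      fun y => annularCutoff y * ‖y‖⁻¹ := by
    ext y
    by_cases hy : y = 0 <;> simp [radialExt, annularCutoff, hy]
  rw [hone] at hpolar
  exact right_ne_zero_of_mul (hpolar ▸ hpos.ne')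

section DivergenceTheorem

variable {f : S2 → ℝ}

theorem IsSmooth.integrable_annularCutoff_mul_fderiv (hf : IsSmooth f) (v : E3) :
    Integrable fun y => annularCutoff y * fderiv ℝ (radialExt f) y v :=
  integrable_mul_of_tsupport_subset isOpen_compl_singleton contDiff_annularCutoff.continuous
    hasCompactSupport_annularCutoff tsupport_annularCutoff_subset_compl_zero fun _ hy =>
      ((hf.contDiffAt_fderiv_radialExt hy).continuousAt.clm_apply
        continuousAt_const).continuousWithinAt

theorem IsSmooth.integrable_fderiv_annularCutoff_mul (hf : IsSmooth f) (v : E3) :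
    Integrable fun y => fderiv ℝ annularCutoff y v * radialExt f y :=
  integrable_mul_of_tsupport_subset isOpen_compl_singleton
    ((contDiff_annularCutoff.continuous_fderiv (by simp)).clm_apply continuous_const)
    (hasCompactSupport_annularCutoff.fderiv_apply ℝ v)
    ((tsupport_fderiv_apply_subset ℝ v).trans tsupport_annularCutoff_subset_compl_zero)
    (isSmooth_iff_contDiffOn_radialExt.1 hf).continuousOn

theorem IsSmooth.integral_annularCutoff_mul_fderiv (hf : IsSmooth f) (v : E3) :
    ∫ y, annularCutoff y * fderiv ℝ (radialExt f) y v =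
      -∫ y, fderiv ℝ annularCutoff y v * radialExt f y :=
  integral_mul_fderiv_eq_neg_fderiv_mul_of_integrable
    (hf.integrable_fderiv_annularCutoff_mul v) (hf.integrable_annularCutoff_mul_fderiv v)
    (integrable_mul_of_tsupport_subset isOpen_compl_singleton contDiff_annularCutoff.continuous
      hasCompactSupport_annularCutoff tsupport_annularCutoff_subset_compl_zero
      (isSmooth_iff_contDiffOn_radialExt.1 hf).continuousOn)
    (fun y _ => contDiff_annularCutoff.differentiable (by simp) y)
    fun _ hy => (hf.contDiffAt_radialExt
      (tsupport_annularCutoff_subset_compl_zero hy)).differentiableAt (by simp)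

variable {η : S2 → Fin 3 → ℝ}

theorem IsOneForm.sum_fderiv_annularCutoff_mul (hη : IsOneForm η) (y : E3) :
    ∑ k, fderiv ℝ annularCutoff y (EuclideanSpace.single k 1) *
      radialExt (fun x => η x k) y = 0 := by
  rcases eq_or_ne y 0 with rfl | hy
  · simp
  obtain ⟨r, hr, x, rfl⟩ := exists_smul_coe_eq hy
  simp only [fderiv_annularCutoff, radialExt_smul_coe _ x hr]
  simp [EuclideanSpace.inner_single_right, mul_assoc, ← Finset.mul_sum, hη.tangential x]

theorem IsOneForm.sum_annularCutoff_mul_fderiv (hη : IsOneForm η) (y : E3) :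
    ∑ k, annularCutoff y * fderiv ℝ (radialExt fun x => η x k) y (EuclideanSpace.single k 1) =
      annulusBump (‖y‖ ^ 2) * ‖y‖⁻¹ * radialExt (divergence₁ η) y := by
  rcases eq_or_ne y 0 with rfl | hy
  · have hzero : annularCutoff (0 : E3) = 0 :=
      image_eq_zero_of_notMem_tsupport fun h => tsupport_annularCutoff_subset_compl_zero h rfl
    simp [hzero]
  have hgrad (k : Fin 3) := congrFun (radialExt_grad (fun x => η x k) k) y
  obtain ⟨r, hr, x, rfl⟩ := exists_smul_coe_eq hy
  simp only [radialExt_smul_coe _ x hr] at hgrad ⊢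
  rw [divergence₁_eq_sum_grad hη.smooth, ← Finset.mul_sum, Finset.sum_congr rfl fun k _ => hgrad k,
    ← Finset.mul_sum, annularCutoff, mul_assoc, inv_mul_cancel_left₀ (norm_ne_zero_iff.2 hy)]

theorem IsOneForm.sphereIntegral_divergence₁_eq_zero (hη : IsOneForm η) :
    sphereIntegral (divergence₁ η) = 0 := by
  have hparts : ∫ y : E3, ∑ k, annularCutoff y *
      fderiv ℝ (radialExt fun x => η x k) y (EuclideanSpace.single k 1) = 0 := by
    rw [integral_finsetSum _ fun k _ => (hη.smooth k).integrable_annularCutoff_mul_fderiv _]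
    simp only [(hη.smooth _).integral_annularCutoff_mul_fderiv, Finset.sum_neg_distrib]
    rw [← integral_finsetSum _ fun k _ => (hη.smooth k).integrable_fderiv_annularCutoff_mul _]
    simp only [hη.sum_fderiv_annularCutoff_mul, integral_zero, neg_zero]
  simp only [hη.sum_annularCutoff_mul_fderiv] at hparts
  rw [integral_radial_mul_radialExt fun r => annulusBump (r ^ 2) * r⁻¹] at hparts
  exact (mul_eq_zero.1 hparts).resolve_right integral_annulusBump_sq_mul_inv_ne_zero

end DivergenceTheorem

end Integration

section Killing

/-- Killing fields of the round metric, as one-forms `Y_A` with antisymmetric covariant derivative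
`Y_{A||B}`. -/
structure IsKilling (Y : S2 → Fin 3 → ℝ) : Prop extends IsOneForm Y where
  covDeriv₁_antisymm : ∀ (x : S2) (i j : Fin 3), covDeriv₁ Y x i j = -covDeriv₁ Y x j i

theorem IsKilling.divergence₁_eq_zero {Y : S2 → Fin 3 → ℝ} (hY : IsKilling Y) (x : S2) :
    divergence₁ Y x = 0 :=
  Finset.sum_eq_zero fun k _ => self_eq_neg.1 (hY.covDeriv₁_antisymm x k k)

theorem isSmooth_dotProduct_coord (a : Fin 3 → ℝ) : IsSmooth fun x => a ⬝ᵥ x.1 :=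
  isSmooth_sum _ fun i _ => (isSmooth_coord i).const_mul (a i)

theorem grad_dotProduct_coord (a : Fin 3 → ℝ) (x : S2) (k : Fin 3) :
    grad (fun y => a ⬝ᵥ y.1) x k = a k - x.1 k * (a ⬝ᵥ x.1) := by
  simp only [dotProduct]
  rw [grad_sum _ fun i _ => (isSmooth_coord i).const_mul (a i)]
  simp only [grad_const_mul _ (isSmooth_coord _), grad_coord, roundMetric_comm x _ k]
  simp only [mul_comm (a _), sum_roundMetric_mul]

theorem dotProduct_mulVec_self_of_antisymm {ι : Type*} [Fintype ι] {A : Matrix ι ι ℝ}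
    (hA : ∀ i j, A i j = -A j i) (v : ι → ℝ) : v ⬝ᵥ A *ᵥ v = 0 := by
  simp only [dotProduct, Matrix.mulVec, Finset.mul_sum, mul_left_comm (v _) (A _ _)]
  exact sum_sum_mul_eq_zero_of_antisymm_of_symm hA fun i j => mul_comm (v i) (v j)

theorem isKilling_mulVec {A : Matrix (Fin 3) (Fin 3) ℝ} (hA : ∀ i j, A i j = -A j i) :
    IsKilling fun x => A *ᵥ x.1 where
  smooth i := isSmooth_dotProduct_coord (A i)
  tangential x := dotProduct_mulVec_self_of_antisymm hA x.1
  covDeriv₁_antisymm x := by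
    have htan : ∑ p, x.1 p * (A *ᵥ x.1) p = 0 := dotProduct_mulVec_self_of_antisymm hA x.1
    have htranspose (k : Fin 3) : ∑ p, x.1 p * A p k = -(A *ᵥ x.1) k := by
      simp only [hA _ k, neg_mul, Finset.sum_neg_distrib, mul_comm (x.1 _)]
      rfl
    have hgrad (p k : Fin 3) :
        grad (fun y => (A *ᵥ y.1) p) x k = A p k - x.1 k * (A *ᵥ x.1) p :=
      grad_dotProduct_coord (A p) x k
    have hcov (i k : Fin 3) : covDeriv₁ (fun x => A *ᵥ x.1) x i k =
        A i k + x.1 i * (A *ᵥ x.1) k - x.1 k * (A *ᵥ x.1) i := by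
      simp only [covDeriv₁, hgrad, mul_sub, Finset.sum_sub_distrib, mul_left_comm _ (x.1 k),
        ← Finset.mul_sum, sum_roundMetric_mul, htranspose, htan]
      ring
    intro i j
    rw [hcov, hcov, hA i j]
    ring

/-- The vector field `ε^{AD} n_{||D}`, obtained from the gradient of `n` by a quarter turn. -/
def skewGrad (n : S2 → ℝ) (x : S2) (i : Fin 3) : ℝ := ∑ l, volForm x i l * grad n x l

theorem skewGrad_dotProduct_coord (a : Fin 3 → ℝ) (x : S2) :
    skewGrad (fun y => a ⬝ᵥ y.1) x = !![0, -a 2, a 1; a 2, 0, -a 0; -a 1, a 0, 0] *ᵥ x.1 := by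
  funext i
  simp only [skewGrad, grad_dotProduct_coord, volForm]
  fin_cases i <;>
    simp [Matrix.det_fin_three, Fin.sum_univ_three, Matrix.mulVec, dotProduct] <;> ring

theorem IsDipole.isKilling_skewGrad {n : S2 → ℝ} (hn : IsDipole n) : IsKilling (skewGrad n) := by
  obtain ⟨a, ha⟩ := hn
  obtain rfl : n = fun x => a ⬝ᵥ x.1 := funext ha
  rw [funext (skewGrad_dotProduct_coord a)]
  refine isKilling_mulVec fun i j => ?_
  fin_cases i <;> fin_cases j <;> simp

theorem IsKilling.sphereIntegral_contract_divergence_eq_zero {Y : S2 → Fin 3 → ℝ}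
    {T : S2 → Fin 3 → Fin 3 → ℝ} {F : S2 → ℝ} (hY : IsKilling Y) (hT : IsTensorField T)
    (hsymm : ∀ (x : S2) (i j : Fin 3), T x i j = T x j i) (hF : IsSmooth F)
    (hdiv : ∀ x j, divergence T x j = grad F x j) :
    sphereIntegral (fun x => ∑ j, (∑ i, Y x i * T x i j) * divergence T x j) = 0 := by
  have hW := hT.contract hY.toIsOneForm
  have hhalf := IsOneForm.smul (hF.const_mul (1 / 2)) hY.toIsOneForm
  have hdivW (x : S2) : divergence₁ (fun y j => ∑ i, Y y i * T y i j) x =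
      ∑ i, Y x i * grad F x i := by
    rw [divergence₁_contract hT hY.toIsOneForm,
      sum_sum_mul_eq_zero_of_antisymm_of_symm (hY.covDeriv₁_antisymm x) (hsymm x), zero_add]
    simp only [hdiv]
  have hdivFY (x : S2) : divergence₁ (fun y i => 1 / 2 * F y * Y y i) x =
      1 / 2 * ∑ i, Y x i * grad F x i := by
    rw [divergence₁_smul (hF.const_mul (1 / 2)) hY.smooth, hY.divergence₁_eq_zero]
    simp only [grad_const_mul _ hF, mul_left_comm (Y x _), ← Finset.mul_sum, mul_zero, zero_add]
  rw [← (IsOneForm.smul hF (hW.sub hhalf)).sphereIntegral_divergence₁_eq_zero]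
  congr 1
  funext x
  rw [divergence₁_smul hF (hW.sub hhalf).smooth, divergence₁_sub hW.smooth hhalf.smooth, hdivW,
    hdivFY]
  simp only [sub_mul, Finset.sum_sub_distrib, hdiv, mul_assoc, ← Finset.mul_sum]
  ring

theorem angMomCN_eq_sub (α : ℝ) (N : S2 → Fin 3 → ℝ) (χ : S2 → Fin 3 → Fin 3 → ℝ)
    (n : S2 → ℝ) :
    angMomCN α N χ n = angMomCJK N χ n - (α - 1) / (32 * Real.pi) *
      sphereIntegral fun x => ∑ j, (∑ i, skewGrad n x i * χ x i j) * divergence χ x j := by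
  have hintegrand (x : S2) :
      ∑ i, ∑ l, ∑ j, volForm x i l * grad n x l * χ x i j * divergence χ x j =
        ∑ j, (∑ i, skewGrad n x i * χ x i j) * divergence χ x j := by
    simp only [skewGrad, Finset.sum_mul]
    conv_rhs => rw [Finset.sum_comm]
    exact Finset.sum_congr rfl fun i _ => Finset.sum_comm
  simp only [angMomCN, hintegrand]

end Killing

end NullInfinity

end

theorem mainTheorem10
    (N : NullInfinity.S2 → Fin 3 → ℝ) (hN : NullInfinity.IsOneForm N)
    (χ : NullInfinity.S2 → Fin 3 → Fin 3 → ℝ) (hχ : NullInfinity.IsSymmTracelessTensor χ)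
    (n : NullInfinity.S2 → ℝ) (hn : NullInfinity.IsDipole n)
    (b c : NullInfinity.S2 → ℝ) (hb : NullInfinity.IsSmooth b) (hc : NullInfinity.IsSmooth c)
    (hpot : ∀ (x : NullInfinity.S2) (i j : Fin 3),
      χ x i j = NullInfinity.tensorOfPotentials c b x i j)
    (hb_zero : b = 0) :
    ∀ α : ℝ, NullInfinity.angMomCJK N χ n = NullInfinity.angMomCN α N χ n := by
  intro α
  subst hb_zero
  obtain rfl : χ = NullInfinity.tensorOfPotentials c 0 :=
    funext fun x => funext fun i => funext fun j => hpot x i j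
  have hcancel := hn.isKilling_skewGrad.sphereIntegral_contract_divergence_eq_zero
    hχ.isTensorField hχ.symm (hc.laplacian.add (hc.const_mul 2))
    (NullInfinity.divergence_tensorOfPotentials_zero_right hc)
  rw [NullInfinity.angMomCN_eq_sub, hcancel, mul_zero, sub_zero]
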